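/- Let $\&$ be a continuous Archimedean t-norm on $[0,1]$: a continuous, commutative, associative operation, monotone in each variable, with $x\,\&\,1=x$ for all $x$, and such that for all $x,y\in(0,1)$ there is some $n\ge 1$ with $x^n<y$, where $x^n=x\,\&\cdots\&\,x$ ($n$ factors). Let $\rightarrow$ be its implication, $x\,\&\,z\le y\iff z\le x\rightarrow y$. A real-enriched category is a set $X$ with a function $X(-,-)\colon X\times X\to[0,1]$ such that $X(x,x)=1$ and $X(y,z)\,\&\,X(x,y)\le X(x,z)$. A functor $f\colon X\to Y$ is a map with $X(x,y)\le Y(f(x),f(y))$; a functor $f\colon X\to Y$ is left adjoint to a functor $g\colon Y\to X$ if $Y(f(x),y)=X(x,g(y))$ for all $x,y$. A weight of $X$ is a function $\phi\colon X\to[0,1]$ with $\phi(y)\,\&\,X(x,y)\le\phi(x)$; weights form a real-enriched category $\mathcal{P}X$ with $\mathcal{P}X(\phi,\psi)=\inf_{x}(\phi(x)\rightarrow\psi(x))$. A colimit of $\phi$ is an element $\operatorname{colim}\phi$ of $X$ (unique up to isomorphism) with $X(\operatorname{colim}\phi,x)=\mathcal{P}X(\phi,X(-,x))$ for all $x$.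 More generally, a colimit of a functor $f\colon K\to X$ weighted by a weight $\phi$ of $K$ is an element $b$ with $X(b,x)=\inf_{k\in K}(\phi(k)\rightarrow X(f(k),x))$ for all $x$. A weight $\phi$ is an ideal if the functor $\mathcal{P}X(\phi,-)\colon\mathcal{P}X\to([0,1],\rightarrow)$ preserves all weighted colimits of functors from real-enriched categories with finitely many elements. Let $\mathcal{J}X\subseteq\mathcal{P}X$ be the full subcategory of the ideals that have a colimit. $X$ is continuous if $\operatorname{colim}\colon\mathcal{J}X\to X$ has a left adjoint. The way below distributor of $X$ is $$\mathfrak{w}(y,x)=\inf_{\phi\in\mathcal{J}X}\bigl(X(x,\operatorname{colim}\phi)\rightarrow\phi(y)\bigr).$$ The ordered (i.e. preordered) set $\mathrm{B}X$ of formal balls is $X\times[0,1]$ with $(x,r)\sqsubseteq(y,s)$ iff $r\le s\,\&\,X(x,y)$. In a preordered set, $p\ll q$ means that for every (nonempty) directed set $D$ with a join $b$ such that $q\le b$ there is $d\in D$ with $p\le d$; the preordered set is continuous if for each $q$ the set $\{p\mid p\ll q\}$ is directed and has $q$ as a join. $X$ is standard if for each directed set $D\subseteq\mathrm{B}X$ of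 formal balls with positive radii that has a join, the set $\{(x,t\,\&\,r)\mid(x,r)\in D\}$ has a join for each $t>0$, and the set $\{(x,t\rightarrow r)\mid(x,r)\in D\}$ has a join for $t=\sup\{r\mid(x,r)\in D\}$. Theorem. Let $X$ be a standard real-enriched category (with respect to the continuous Archimedean t-norm $\&$). Then $X$ is continuous if and only if the ordered set $\mathrm{B}X$ is continuous. In this case, for all $x,y\in X$ and all $r,s>0$, $$(x,r)\ll(y,s)\iff r<s\,\&\,\mathfrak{w}(x,y).$$ -/

import Mathlib

open unitInterval

universe u v w

namespace RealEnriched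

/-- A continuous t-norm on the unit interval `[0,1]`. -/
structure ContinuousTNorm where
  op : I → I → I
  comm : ∀ x y, op x y = op y x
  assoc : ∀ x y z, op (op x y) z = op x (op y z)
  mono : ∀ x y z, y ≤ z → op x y ≤ op x z
  op_one : ∀ x, op x 1 = x
  continuous_op : Continuous fun p : I × I => op p.1 p.2

namespace ContinuousTNorm

variable (T : ContinuousTNorm)

/-- Powers with respect to the t-norm: `pow x 1 = x` and `pow x (n + 1) = op (pow x n) x`. -/
def pow (x : I) : ℕ → I
  | 0 => 1
  | n + 1 => T.op (pow x n) x

/-- For all `x, y ∈ (0,1)` there is some positive integer `n` with `x ^ n < y`. -/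
def IsArchimedean : Prop :=
  ∀ x y : I, 0 < x → x < 1 → 0 < y → y < 1 → ∃ n : ℕ, 1 ≤ n ∧ T.pow x n < y

/-- The implication of the t-norm, i.e. the right adjoint of `op x` (see `op_le_iff`). -/
noncomputable def imp (x y : I) : I := sSup {z | T.op x z ≤ y}

theorem one_op (x : I) : T.op 1 x = x := by rw [T.comm, T.op_one]

theorem op_zero (x : I) : T.op x 0 = 0 := by
  have h := T.mono 0 x 1 unitInterval.le_one'
  rw [T.op_one, T.comm] at h
  exact le_antisymm h unitInterval.nonneg'

theorem op_le_iff (x y z : I) : T.op x z ≤ y ↔ z ≤ T.imp x y := by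
  have hmem : T.imp x y ∈ {z | T.op x z ≤ y} := by
    have hc : IsClosed {z | T.op x z ≤ y} :=
      isClosed_le (T.continuous_op.comp (by fun_prop : Continuous fun z : I => (x, z)))
        continuous_const
    refine hc.sSup_mem ⟨0, ?_⟩
    show T.op x 0 ≤ y
    rw [T.op_zero]
    exact unitInterval.nonneg'
  exact ⟨fun h => le_sSup h, fun h => (T.mono x _ _ h).trans hmem⟩

theorem imp_self (x : I) : T.imp x x = 1 :=
  le_antisymm unitInterval.le_one' ((T.op_le_iff _ _ _).1 (T.op_one x).le)

theorem mono_left (x y z : I) (h : x ≤ y) : T.op x z ≤ T.op y z := by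
  rw [T.comm x, T.comm y]; exact T.mono z x y h

theorem op_imp_le (x y : I) : T.op x (T.imp x y) ≤ y := (T.op_le_iff _ _ _).2 le_rfl

theorem imp_trans (x y z : I) : T.op (T.imp y z) (T.imp x y) ≤ T.imp x z := by
  rw [← T.op_le_iff, T.comm (T.imp y z), ← T.assoc]
  exact (T.mono_left _ _ _ (T.op_imp_le x y)).trans (T.op_imp_le y z)

end ContinuousTNorm

/-- A real-enriched category structure on `X`, with respect to the continuous t-norm `T`. -/
structure Cat (T : ContinuousTNorm) (X : Type u) where
  hom : X → X → I
  hom_self : ∀ x, hom x x = 1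
  trans : ∀ x y z, T.op (hom y z) (hom x y) ≤ hom x z

variable {T : ContinuousTNorm}

def IsFunctor {X : Type u} {Y : Type v} (A : Cat T X) (B : Cat T Y) (f : X → Y) : Prop :=
  ∀ x y, A.hom x y ≤ B.hom (f x) (f y)

/-- `f` and `g` are functors and `f` is left adjoint to `g`. -/
def IsAdjunction {X : Type u} {Y : Type v} (A : Cat T X) (B : Cat T Y)
    (f : X → Y) (g : Y → X) : Prop :=
  IsFunctor A B f ∧ IsFunctor B A g ∧ ∀ x y, B.hom (f x) y = A.hom x (g y)

/-- The full subcategory of `A` on the elements satisfying `P`. -/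
def Cat.full {X : Type u} (A : Cat T X) (P : X → Prop) : Cat T {x // P x} where
  hom x y := A.hom x y
  hom_self x := A.hom_self x
  trans x y z := A.trans x y z

/-- The real-enriched category `V = ([0,1], x → y)`. -/
noncomputable def catV (T : ContinuousTNorm) : Cat T I where
  hom := T.imp
  hom_self := T.imp_self
  trans := T.imp_trans

/-- A weight of `A`, i.e. a distributor from `A` to the terminal category. -/
structure Weight {X : Type u} (A : Cat T X) where
  val : X → I
  isWeight : ∀ x y, T.op (val y) (A.hom x y) ≤ val x

/-- The real-enriched category `𝒫 A` of weights of `A`, with hom `inf_x (φ x → ψ x)`. -/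
noncomputable def weightCat {X : Type u} (A : Cat T X) : Cat T (Weight A) where
  hom φ ψ := ⨅ x, T.imp (φ.val x) (ψ.val x)
  hom_self _ := le_antisymm unitInterval.le_one' (le_iInf fun _ => (T.imp_self _).ge)
  trans φ ψ χ := le_iInf fun x =>
    ((T.mono_left _ _ _ (iInf_le _ x)).trans (T.mono _ _ _ (iInf_le _ x))).trans
      (T.imp_trans (φ.val x) (ψ.val x) (χ.val x))

/-- The Yoneda embedding `a ↦ A(-, a)`. -/
def yoneda {X : Type u} (A : Cat T X) (a : X) : Weight A where
  val x := A.hom x a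
  isWeight x y := A.trans x y a

/-- `b` is a colimit of the weight `φ`. -/
def IsColimit {X : Type u} (A : Cat T X) (φ : Weight A) (b : X) : Prop :=
  ∀ x, A.hom b x = (weightCat A).hom φ (yoneda A x)

/-- `b` is a colimit of `f : C → A` weighted by `φ`: `A(b, x) = 𝒫 C (φ, A(f -, x))`. -/
def IsWeightedColimit {K : Type w} {X : Type u} (C : Cat T K) (A : Cat T X) (f : K → X)
    (φ : Weight C) (b : X) : Prop :=
  ∀ x, A.hom b x = ⨅ k, T.imp (φ.val k) (A.hom (f k) x)

/-- `f` preserves the colimits of all functors from finite categories, for all weights. -/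
def PreservesFiniteColimits {X : Type u} {Y : Type v} (A : Cat T X) (B : Cat T Y)
    (f : X → Y) : Prop :=
  ∀ (K : Type) [Finite K] (C : Cat T K) (h : K → X), IsFunctor C A h →
    ∀ (φ : Weight C) (b : X), IsWeightedColimit C A h φ b →
      IsWeightedColimit C B (f ∘ h) φ (f b)

/-- `φ` is an ideal: the functor `𝒫 A (φ, -) : 𝒫 A → V` preserves finite colimits. -/
def IsIdeal {X : Type u} (A : Cat T X) (φ : Weight A) : Prop :=
  PreservesFiniteColimits (weightCat A) (catV T) ((weightCat A).hom φ)

/-- The ideals of `A` that have a colimit. -/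
def IdealWithColimit {X : Type u} (A : Cat T X) : Type u :=
  {φ : Weight A // IsIdeal A φ ∧ ∃ b, IsColimit A φ b}

/-- The real-enriched category `𝒥 A`, a full subcategory of `𝒫 A`. -/
noncomputable def idealCat {X : Type u} (A : Cat T X) : Cat T (IdealWithColimit A) :=
  (weightCat A).full _

/-- The map `𝒥 A → A` that picks a colimit (unique up to isomorphism) of each member of `𝒥 A`. -/
noncomputable def colim {X : Type u} (A : Cat T X) (φ : IdealWithColimit A) : X :=
  φ.2.2.choose

/-- `A` is continuous: `colim : 𝒥 A → A` has a left adjoint. -/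
def IsContinuous {X : Type u} (A : Cat T X) : Prop :=
  ∃ d : X → IdealWithColimit A, IsAdjunction A (idealCat A) d (colim A)

/-- The way below distributor. -/
noncomputable def wayBelowDist {X : Type u} (A : Cat T X) (y x : X) : I :=
  ⨅ φ : IdealWithColimit A, T.imp (A.hom x (colim A φ)) (φ.1.val y)

/-- Formal balls of `A`. -/
@[ext]
structure FormalBall {X : Type u} (A : Cat T X) where
  center : X
  radius : I

/-- The order of formal balls: `(x, r) ⊑ (y, s)` if `r ≤ s & A(x, y)`. -/
instance {X : Type u} (A : Cat T X) : Preorder (FormalBall A) where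
  le p q := p.radius ≤ T.op q.radius (A.hom p.center q.center)
  le_refl p := by rw [A.hom_self, T.op_one]
  le_trans p q s hpq hqs := by
    refine hpq.trans ((T.mono_left _ _ _ hqs).trans ?_)
    rw [T.assoc]
    exact T.mono _ _ _ (A.trans _ _ _)

/-- The way below relation of a preordered set. -/
def WayBelow {P : Type u} [Preorder P] (x y : P) : Prop :=
  ∀ D : Set P, D.Nonempty → DirectedOn (· ≤ ·) D →
    ∀ b, IsLUB D b → y ≤ b → ∃ d ∈ D, x ≤ d

/-- Continuity of a preordered set: for each `x`, the set of elements way below `x` is directed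
(in particular nonempty) and has `x` as a join. -/
def IsContinuousOrder (P : Type u) [Preorder P] : Prop :=
  ∀ x : P, {y | WayBelow y x}.Nonempty ∧ DirectedOn (· ≤ ·) {y | WayBelow y x} ∧
    IsLUB {y | WayBelow y x} x

/-- `A` is standard: for each directed set `D` of formal balls with positive radii that has a join,
the sets of all `(x, t & r)` with `(x, r) ∈ D` (for each `t > 0`), and of all `(x, t → r)` with
`(x, r) ∈ D` (for `t` the supremum of the radii), have joins as well. Asking this only of those `D`
whose radii are all positive is weaker than asking it of all `D` whose radii have a positive
supremum: a ball of radius `0` lies below every ball, but `(x, t → 0)` need not. -/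
def IsStandard {X : Type u} (A : Cat T X) : Prop :=
  ∀ D : Set (FormalBall A), D.Nonempty → DirectedOn (· ≤ ·) D → (∀ p ∈ D, 0 < p.radius) →
    (∃ b, IsLUB D b) →
      (∀ t : I, 0 < t →
        ∃ b, IsLUB ((fun p : FormalBall A => (⟨p.center, T.op t p.radius⟩ : FormalBall A)) '' D) b) ∧
      ∃ b, IsLUB ((fun p : FormalBall A =>
        (⟨p.center, T.imp (sSup (FormalBall.radius '' D)) p.radius⟩ : FormalBall A)) '' D) b

end RealEnriched

/-! Ideals and directed sets of formal balls are two views of one object. A directed `D` whose radii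
have supremum 1 generates an ideal `ballWeight D`; conversely, for an ideal `φ` the balls `(x, r)`
with `r < φ x` form such a set and generate `φ` again. If `b` is a colimit of `ballWeight D`, then
`(b, t)` is a join of `t & D` for all `t > 0` (`isLUB_scale`). Standardness gives the converse: a
directed set of positive radii with join `(c, u)`, divided by `u`, generates an ideal with colimit
`c` (`IsStandard.isColimit_unscale`). The Archimedean property enters as cancellation of nonzero
products.

Hence `≪` between balls can be tested on ideals, so `r < s & 𝔴(x, y)` implies `(x, r) ≪ (y, s)`. If
`colim` has a left adjoint `d`, then `𝔴(-, y) = d y` is an ideal with colimit `y`, and its balls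
scaled by `s` are a directed set of approximants of `(y, s)`. Conversely, if the order is
continuous, the balls of positive radius way below `(y, 1)` generate the ideal `d y`; the adjunction
holds because `≪` survives scaling (`IsContinuousOrder.scale_wayBelow`). -/

namespace RealEnriched

/-! ### Divisibility and cancellation for Archimedean t-norms -/

namespace ContinuousTNorm

variable (T : ContinuousTNorm)

theorem op_left_comm (x y z : I) : T.op x (T.op y z) = T.op y (T.op x z) := by
  rw [← T.assoc, T.comm x y, T.assoc]

theorem op_right_comm (x y z : I) : T.op (T.op x y) z = T.op (T.op x z) y := by
  rw [T.assoc, T.comm y z, T.assoc]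

theorem op_le_left (x y : I) : T.op x y ≤ x :=
  (T.mono x y 1 unitInterval.le_one').trans (T.op_one x).le

theorem op_le_right (x y : I) : T.op x y ≤ y := by
  rw [T.comm]; exact T.op_le_left y x

theorem le_imp (x y : I) : y ≤ T.imp x y := (T.op_le_iff _ _ _).1 (T.op_le_right x y)

theorem one_imp (x : I) : T.imp 1 x = x := by
  refine le_antisymm ?_ (T.le_imp 1 x)
  have := T.op_imp_le 1 x
  rwa [T.one_op] at this

theorem op_sSup_le_iff (t c : I) (S : Set I) : T.op t (sSup S) ≤ c ↔ ∀ a ∈ S, T.op t a ≤ c := by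
  rw [T.op_le_iff, sSup_le_iff]
  exact forall₂_congr fun a _ => (T.op_le_iff t c a).symm

theorem lt_op_sSup_iff (t c : I) (S : Set I) : c < T.op t (sSup S) ↔ ∃ a ∈ S, c < T.op t a := by
  rw [← not_iff_not]
  push Not
  exact T.op_sSup_le_iff t c S

theorem op_iSup_le_iff {ι : Sort*} (t c : I) (f : ι → I) :
    T.op t (⨆ i, f i) ≤ c ↔ ∀ i, T.op t (f i) ≤ c := by
  rw [T.op_le_iff, iSup_le_iff]
  exact forall_congr' fun i => (T.op_le_iff t c (f i)).symm

/-- Divisibility of a continuous t-norm. -/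
theorem op_imp_of_le {x y : I} (h : y ≤ x) : T.op x (T.imp x y) = y := by
  refine le_antisymm (T.op_imp_le x y) ?_
  have hc : Continuous fun z : I => T.op x z :=
    T.continuous_op.comp (by fun_prop : Continuous fun z : I => (x, z))
  have hy : y ∈ Set.Icc (T.op x 0) (T.op x 1) := by
    rw [T.op_zero, T.op_one]
    exact ⟨unitInterval.nonneg', h⟩
  obtain ⟨z, hz⟩ := intermediate_value_univ 0 1 hc hy
  have hz : T.op x z = y := hz
  exact hz.ge.trans (T.mono _ _ _ ((T.op_le_iff _ _ _).1 hz.le))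

variable {T}

/-- If `t` absorbs `u`, it absorbs every power of `u`, so all these powers stay above `t`. -/
theorem IsArchimedean.eq_one_of_op_eq (hT : T.IsArchimedean) {t u : I} (ht : 0 < t)
    (h : T.op t u = t) : u = 1 := by
  by_contra hu
  have hu1 : u < 1 := lt_of_le_of_ne unitInterval.le_one' hu
  have hu0 : 0 < u := ht.trans_le (h.ge.trans (T.op_le_right t u))
  have hpow : ∀ n, T.op t (T.pow u n) = t := by
    intro n
    induction n with
    | zero => exact T.op_one t
    | succ n ih =>
      show T.op t (T.op (T.pow u n) u) = t
      rw [← T.assoc, ih, h]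
  -- The minimum keeps the target below 1 even if `t = 1`.
  obtain ⟨n, -, hn⟩ := hT u (min t u) hu0 hu1 (lt_min ht hu0) ((min_le_right _ _).trans_lt hu1)
  have h1 : t ≤ T.pow u n := (hpow n).ge.trans (T.op_le_right _ _)
  exact absurd (h1.trans_lt hn) (not_lt.2 (min_le_left _ _))

/-- If `v < r`, divisibility gives `v = r & (r → v)`, so the nonzero `t & r` absorbs `r → v`, which
is then 1. -/
theorem IsArchimedean.cancel (hT : T.IsArchimedean) {t r v : I} (h0 : 0 < T.op t r)
    (h : T.op t r ≤ T.op t v) : r ≤ v := by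
  by_contra hlt
  have hvr : v ≤ r := (not_le.1 hlt).le
  have hv : T.op r (T.imp r v) = v := T.op_imp_of_le hvr
  have h1 : T.op (T.op t r) (T.imp r v) = T.op t r := by
    refine le_antisymm (T.op_le_left _ _) ?_
    rw [T.assoc, hv]
    exact h
  have h2 := hT.eq_one_of_op_eq h0 h1
  rw [h2, T.op_one] at hv
  exact hlt hv.le

theorem IsArchimedean.le_op_iInf (hT : T.IsArchimedean) {ι : Sort*} [Nonempty ι] {w L : I}
    (f : ι → I) (h : ∀ i, L ≤ T.op w (f i)) : L ≤ T.op w (⨅ i, f i) := by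
  rcases eq_or_lt_of_le (unitInterval.nonneg' : 0 ≤ L) with h0 | h0
  · rw [← h0]
    exact unitInterval.nonneg'
  · have hL : T.op w (T.imp w L) = L :=
      T.op_imp_of_le ((h (Classical.arbitrary ι)).trans (T.op_le_left _ _))
    rw [← hL] at h0 h
    rw [← hL]
    exact T.mono _ _ _ (le_iInf fun i => hT.cancel h0 (h i))

end ContinuousTNorm

/-! ### Weights, their combinations, and ideals -/

section Weights

variable {X : Type u} {A : Cat T X}

theorem Cat.hom_eq_of_iso {b c : X} (h1 : A.hom b c = 1) (h2 : A.hom c b = 1) (x : X) :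
    A.hom b x = A.hom c x := by
  apply le_antisymm
  · have := A.trans c b x
    rwa [h2, T.op_one] at this
  · have := A.trans b c x
    rwa [h1, T.op_one] at this

theorem le_weightHom_iff {φ ψ : Weight A} {c : I} :
    c ≤ (weightCat A).hom φ ψ ↔ ∀ x, T.op (φ.val x) c ≤ ψ.val x := by
  show c ≤ ⨅ x, T.imp (φ.val x) (ψ.val x) ↔ _
  rw [le_iInf_iff]
  exact forall_congr' fun x => (T.op_le_iff _ _ _).symm

theorem weightHom_eq_one_iff {φ ψ : Weight A} :
    (weightCat A).hom φ ψ = 1 ↔ ∀ x, φ.val x ≤ ψ.val x := by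
  have h : (weightCat A).hom φ ψ = 1 ↔ 1 ≤ (weightCat A).hom φ ψ :=
    ⟨ge_of_eq, le_antisymm unitInterval.le_one'⟩
  rw [h, le_weightHom_iff]
  simp only [T.op_one]

theorem op_weightHom_le (φ ψ : Weight A) (x : X) :
    T.op (φ.val x) ((weightCat A).hom φ ψ) ≤ ψ.val x :=
  le_weightHom_iff.1 le_rfl x

theorem IsColimit.le_hom {φ : Weight A} {b : X} (h : IsColimit A φ b) (x : X) :
    φ.val x ≤ A.hom x b := by
  have := weightHom_eq_one_iff.1 ((h b).symm.trans (A.hom_self b))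
  exact this x

theorem IsColimit.of_iso {φ : Weight A} {b c : X} (h : IsColimit A φ b)
    (h1 : A.hom b c = 1) (h2 : A.hom c b = 1) : IsColimit A φ c := fun x => by
  rw [← h x, Cat.hom_eq_of_iso h1 h2]

theorem IsColimit.hom_eq_one {φ : Weight A} {b c : X} (h : IsColimit A φ b)
    (h' : IsColimit A φ c) : A.hom b c = 1 := by
  rw [h c, ← h' c, A.hom_self]

theorem isColimit_colim (φ : IdealWithColimit A) : IsColimit A φ.1 (colim A φ) :=
  φ.2.2.choose_spec

/-- The combination `x ↦ ⨆ k, c k & ψ k x` of weights. -/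
noncomputable def Weight.combination {K : Type w} (c : K → I) (ψ : K → Weight A) : Weight A where
  val x := ⨆ k, T.op (c k) ((ψ k).val x)
  isWeight x y := by
    rw [T.comm, T.op_iSup_le_iff]
    intro k
    rw [T.comm, T.assoc]
    exact (T.mono _ _ _ ((ψ k).isWeight x y)).trans
      (le_iSup (fun k => T.op (c k) ((ψ k).val x)) k)

/-- The universal property of a colimit of `ψ` weighted by `c` over the discrete category on `K`. -/
theorem combination_hom {K : Type w} (c : K → I) (ψ : K → Weight A) (χ : Weight A) :
    (weightCat A).hom (Weight.combination c ψ) χ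
      = ⨅ k, T.imp (c k) ((weightCat A).hom (ψ k) χ) := by
  refine eq_of_forall_le_iff fun a => ?_
  rw [le_weightHom_iff, le_iInf_iff]
  simp only [← T.op_le_iff, le_weightHom_iff, Weight.combination]
  rw [forall_comm]
  refine forall_congr' fun x => ?_
  rw [T.comm, T.op_iSup_le_iff]
  refine forall_congr' fun k => ?_
  rw [T.op_left_comm, ← T.assoc, ← T.assoc, T.op_right_comm, T.comm (c k)]

/-- The discrete real-enriched category. -/
noncomputable def discreteCat (T : ContinuousTNorm) (K : Type w) : Cat T K where
  hom i j := by
    classical exact if i = j then 1 else 0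
  hom_self i := by simp
  trans i j k := by
    by_cases h1 : i = j
    · subst h1
      simp [T.op_one]
    · simp [h1, T.op_zero]

theorem discreteCat_isFunctor {K : Type w} {Y : Type v} (B : Cat T Y) (f : K → Y) :
    IsFunctor (discreteCat T K) B f := by
  intro i j
  by_cases h : i = j
  · subst h
    rw [B.hom_self]
    exact unitInterval.le_one'
  · simp [discreteCat, h]

/-- Every function is a weight of a discrete category. -/
def discreteWeight {K : Type w} (c : K → I) : Weight (discreteCat T K) where
  val := c
  isWeight i j := by
    by_cases h : i = j
    · subst h
      exact T.op_le_left _ _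
    · simp [discreteCat, h, T.op_zero]

/-- Preservation of the colimit is evaluated at the right-hand side itself, where the infimum over
`k` is 1. -/
theorem IsIdeal.hom_combination_le {φ : Weight A} (hφ : IsIdeal A φ) {K : Type} [Finite K]
    (c : K → I) (ψ : K → Weight A) :
    (weightCat A).hom φ (Weight.combination c ψ)
      ≤ ⨆ k, T.op (c k) ((weightCat A).hom φ (ψ k)) := by
  have h := hφ K (discreteCat T K) ψ (discreteCat_isFunctor _ _) (discreteWeight c)
    (Weight.combination c ψ) (combination_hom c ψ)
    (⨆ k, T.op (c k) ((weightCat A).hom φ (ψ k)))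
  have h1 : (1 : I) ≤ T.imp ((weightCat A).hom φ (Weight.combination c ψ))
      (⨆ k, T.op (c k) ((weightCat A).hom φ (ψ k))) := by
    refine le_of_le_of_eq (le_iInf fun k => ?_) h.symm
    rw [← T.op_le_iff, T.op_one]
    refine (T.op_le_iff _ _ _).1 ?_
    rw [T.comm]
    exact le_iSup (fun k => T.op (c k) ((weightCat A).hom φ (ψ k))) k
  rwa [← T.op_le_iff, T.op_one] at h1

/-- A weighted colimit of weights agrees pointwise with the combination, whatever the category
structure on `K`, and the reverse inequality is automatic. -/
theorem isIdeal_of_hom_combination_le {φ : Weight A}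
    (h : ∀ (K : Type) [Finite K] (c : K → I) (ψ : K → Weight A),
      (weightCat A).hom φ (Weight.combination c ψ)
        ≤ ⨆ k, T.op (c k) ((weightCat A).hom φ (ψ k))) : IsIdeal A φ := by
  intro K _ C f _ w b hb x
  have hle : ∀ y, b.val y ≤ (Weight.combination w.val f).val y := by
    rw [← weightHom_eq_one_iff, hb, ← combination_hom, (weightCat A).hom_self]
  have hge : ∀ y, (Weight.combination w.val f).val y ≤ b.val y := by
    rw [← weightHom_eq_one_iff, combination_hom, ← hb, (weightCat A).hom_self]
  show T.imp ((weightCat A).hom φ b) x = ⨅ k, T.imp (w.val k) (T.imp ((weightCat A).hom φ (f k)) x)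
  refine eq_of_forall_le_iff fun a => ?_
  simp only [le_iInf_iff, ← T.op_le_iff]
  constructor
  · intro ha k
    rw [← T.assoc, T.comm _ (w.val k)]
    refine (T.mono_left _ _ _ (le_weightHom_iff.2 fun y => ?_)).trans ha
    rw [T.op_left_comm]
    exact ((T.mono _ _ _ (op_weightHom_le φ (f k) y)).trans
      (le_iSup (fun k => T.op (w.val k) ((f k).val y)) k)).trans (hge y)
  · intro ha
    have h1 : (weightCat A).hom φ b ≤ ⨆ k, T.op (w.val k) ((weightCat A).hom φ (f k)) :=
      le_trans (le_weightHom_iff.2 fun y => (op_weightHom_le φ b y).trans (hle y)) (h K w.val f)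
    refine (T.mono_left _ _ _ h1).trans ?_
    rw [T.comm, T.op_iSup_le_iff]
    intro k
    rw [T.comm, T.comm (w.val k), T.assoc]
    exact ha k

theorem isAdjunction_of_hom_eq {Y : Type v} {B : Cat T Y} {f : X → Y} {g : Y → X}
    (h : ∀ x y, B.hom (f x) y = A.hom x (g y)) : IsAdjunction A B f g := by
  refine ⟨fun x y => ?_, fun y z => ?_, h⟩
  · have h1 := A.trans x y (g (f y))
    rw [← h y (f y), B.hom_self, T.one_op] at h1
    rwa [h]
  · have h1 := B.trans (f (g y)) y z
    rw [h _ y, A.hom_self, T.op_one] at h1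
    rwa [← h]

end Weights

/-! ### Directed sets of formal balls versus ideals and their colimits -/

section Balls

variable {X : Type u} {A : Cat T X}

theorem FormalBall.le_def {p q : FormalBall A} :
    p ≤ q ↔ p.radius ≤ T.op q.radius (A.hom p.center q.center) := Iff.rfl

theorem FormalBall.radius_le {p q : FormalBall A} (h : p ≤ q) : p.radius ≤ q.radius :=
  (FormalBall.le_def.1 h).trans (T.op_le_left _ _)

theorem FormalBall.le_of_radius_eq_zero {p q : FormalBall A} (h : p.radius = 0) : p ≤ q := by
  rw [FormalBall.le_def, h]
  exact unitInterval.nonneg'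

/-- The ball with the radius multiplied by `t`. -/
def FormalBall.scale (t : I) (p : FormalBall A) : FormalBall A := ⟨p.center, T.op t p.radius⟩

/-- The ball with the radius divided by `t`. -/
noncomputable def FormalBall.unscale (t : I) (p : FormalBall A) : FormalBall A :=
  ⟨p.center, T.imp t p.radius⟩

theorem FormalBall.scale_mono (t : I) : Monotone (FormalBall.scale (A := A) t) := by
  intro p q h
  show T.op t p.radius ≤ T.op (T.op t q.radius) (A.hom p.center q.center)
  rw [T.assoc]
  exact T.mono _ _ _ h

theorem directedOn_scale {D : Set (FormalBall A)} (hD : DirectedOn (· ≤ ·) D) (t : I) :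
    DirectedOn (· ≤ ·) (FormalBall.scale t '' D) := by
  rintro _ ⟨p, hp, rfl⟩ _ ⟨q, hq, rfl⟩
  obtain ⟨z, hz, h1, h2⟩ := hD p hp q hq
  exact ⟨_, ⟨z, hz, rfl⟩, FormalBall.scale_mono t h1, FormalBall.scale_mono t h2⟩

theorem scale_unscale {t : I} {p : FormalBall A} (h : p.radius ≤ t) :
    (p.unscale t).scale t = p := by
  ext1
  · rfl
  · exact T.op_imp_of_le h

/-- Positivity of the radius is what permits cancelling `t`: `t → 0` may be nonzero. -/
theorem unscale_le_unscale (hT : T.IsArchimedean) {t : I} {p q : FormalBall A}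
    (h0 : 0 < p.radius) (hq : q.radius ≤ t) (h : p ≤ q) : p.unscale t ≤ q.unscale t := by
  have hp := (FormalBall.radius_le h).trans hq
  apply hT.cancel (t := t)
  · exact h0.trans_eq (T.op_imp_of_le hp).symm
  · show T.op t (T.imp t p.radius) ≤ T.op t (T.op (T.imp t q.radius) (A.hom p.center q.center))
    rw [← T.assoc, T.op_imp_of_le hp, T.op_imp_of_le hq]
    exact h

/-- The weight `y ↦ ⨆ (x, r) ∈ D, r & A(y, x)` generated by a set of formal balls. -/
noncomputable def ballWeight (D : Set (FormalBall A)) : Weight A where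
  val y := ⨆ p : D, T.op p.1.radius (A.hom y p.1.center)
  isWeight x y := by
    rw [T.comm, T.op_iSup_le_iff]
    intro p
    rw [T.comm, T.assoc]
    exact (T.mono _ _ _ (A.trans _ _ _)).trans
      (le_iSup (fun p : D => T.op p.1.radius (A.hom x p.1.center)) p)

theorem le_ballWeight {D : Set (FormalBall A)} {p : FormalBall A} (hp : p ∈ D) (y : X) :
    T.op p.radius (A.hom y p.center) ≤ (ballWeight D).val y :=
  le_iSup (fun p : D => T.op p.1.radius (A.hom y p.1.center)) ⟨p, hp⟩

theorem le_hom_ballWeight_iff {D : Set (FormalBall A)} {ψ : Weight A} {c : I} :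
    c ≤ (weightCat A).hom (ballWeight D) ψ ↔ ∀ p ∈ D, T.op p.radius c ≤ ψ.val p.center := by
  rw [le_weightHom_iff]
  constructor
  · intro h p hp
    refine (T.mono_left _ _ _ ?_).trans (h p.center)
    have := le_ballWeight hp p.center
    rwa [A.hom_self, T.op_one] at this
  · intro h x
    rw [T.comm]
    refine (T.op_iSup_le_iff _ _ _).2 fun p => ?_
    rw [T.comm, T.op_right_comm]
    exact (T.mono_left _ _ _ (h p.1 p.2)).trans (ψ.isWeight _ _)

/-- Bounds on a directed set need only be checked on arbitrarily high balls. -/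
theorem op_radius_le_of_le {p q : FormalBall A} {ψ : Weight A} {c : I} (h : p ≤ q)
    (hq : T.op q.radius c ≤ ψ.val q.center) : T.op p.radius c ≤ ψ.val p.center := by
  refine (T.mono_left _ _ _ h).trans ?_
  rw [T.op_right_comm]
  exact (T.mono_left _ _ _ hq).trans (ψ.isWeight _ _)

/-- Were the inequality strict the wrong way, finitely many witnesses, one for each `k`, would lie
below a single ball `z` of `D`. Balls above `z` only sharpen the bound `M`, and their radii have
supremum 1, so `L ≤ M < L`. -/
theorem isIdeal_ballWeight (hT : T.IsArchimedean) {D : Set (FormalBall A)} (hne : D.Nonempty)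
    (hD : DirectedOn (· ≤ ·) D) (h1 : sSup (FormalBall.radius '' D) = 1) :
    IsIdeal A (ballWeight D) := by
  refine isIdeal_of_hom_combination_le fun K _ c ψ => ?_
  set φ := ballWeight D
  set L := (weightCat A).hom φ (Weight.combination c ψ)
  by_contra hlt
  rw [not_le] at hlt
  have : Nonempty D := hne.to_subtype
  have hex : ∀ k, ∃ p : D, T.op (c k) (T.imp p.1.radius ((ψ k).val p.1.center)) < L := by
    intro k
    by_contra hcon
    push Not at hcon
    -- By cancellation `c k & -` commutes with the infimum over `D` that computes the hom into `ψ
    -- k`.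
    have h2 := hT.le_op_iInf _ hcon
    refine absurd (h2.trans (T.mono _ _ _ (le_hom_ballWeight_iff.2 fun p hp => ?_)))
      (not_le.2 ((le_iSup (fun k => T.op (c k) ((weightCat A).hom φ (ψ k))) k).trans_lt hlt))
    rw [T.op_le_iff]
    exact iInf_le (fun p : D => T.imp p.1.radius ((ψ k).val p.1.center)) ⟨p, hp⟩
  choose g hg using hex
  obtain ⟨z, hz⟩ := (directedOn_iff_directed.1 hD).finite_le g
  set M := ⨆ k, T.op (c k) (T.imp z.1.radius ((ψ k).val z.1.center))
  -- A finite supremum is attained; for empty `K` it is 0.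
  have hM : M < L := by
    rcases isEmpty_or_nonempty K with hK | hK
    · have : M = 0 := le_antisymm (iSup_le fun k => (hK.false k).elim) unitInterval.nonneg'
      rw [this]
      exact lt_of_le_of_lt unitInterval.nonneg' hlt
    · obtain ⟨k, hk⟩ := exists_eq_ciSup_of_finite
        (f := fun k => T.op (c k) (T.imp z.1.radius ((ψ k).val z.1.center)))
      refine lt_of_le_of_lt (le_trans hk.ge (T.mono _ _ _ ?_)) (hg k)
      rw [← T.op_le_iff]
      exact op_radius_le_of_le (hz k) (T.op_imp_le _ _)
  refine absurd (?_ : L ≤ M) (not_le.2 hM)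
  rw [← T.op_one L, ← h1, T.op_sSup_le_iff]
  rintro _ ⟨p, hp, rfl⟩
  obtain ⟨q, hq, hpq, hzq⟩ := hD p hp z.1 z.2
  refine (T.mono _ _ _ (FormalBall.radius_le hpq)).trans ?_
  rw [T.comm]
  refine (le_hom_ballWeight_iff.1 le_rfl q hq).trans (iSup_mono fun k => T.mono _ _ _ ?_)
  rw [← T.op_le_iff]
  exact op_radius_le_of_le hzq (T.op_le_right _ _)

/-- The formal balls `(x, r)` with `r < φ x`. -/
def ballsBelow (φ : Weight A) : Set (FormalBall A) := {p | p.radius < φ.val p.center}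

theorem ballWeight_ballsBelow (φ : Weight A) : ballWeight (ballsBelow φ) = φ := by
  have h : (ballWeight (ballsBelow φ)).val = φ.val := by
    funext y
    apply le_antisymm
    · refine iSup_le fun p => (T.mono_left _ _ _ (le_of_lt p.2)).trans (φ.isWeight _ _)
    · refine le_of_forall_lt fun r hr => ?_
      obtain ⟨s, hrs, hs⟩ := exists_between hr
      have := le_ballWeight (D := ballsBelow φ) (p := ⟨y, s⟩) hs y
      rw [A.hom_self, T.op_one] at this
      exact hrs.trans_le this
  cases φ
  simpa [ballWeight] using h

/-- The constant weight with value one. -/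
def oneWeight (A : Cat T X) : Weight A where
  val _ := 1
  isWeight _ _ := unitInterval.le_one'

/-- The constant weight `c & 1` bounds `φ`; preserving this one-term colimit moves `c` out of the
hom, so `1 ≤ c`. -/
theorem IsIdeal.sSup_eq_one {φ : Weight A} (hφ : IsIdeal A φ) :
    sSup (FormalBall.radius '' ballsBelow φ) = 1 := by
  refine le_antisymm unitInterval.le_one' ?_
  set c := sSup (FormalBall.radius '' ballsBelow φ)
  have hc : ∀ x, φ.val x ≤ c := fun x => le_of_forall_lt fun r hr => by
    obtain ⟨s, hrs, hs⟩ := exists_between hr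
    exact hrs.trans_le (le_sSup ⟨⟨x, s⟩, hs, rfl⟩)
  have h := hφ.hom_combination_le (K := Unit) (fun _ => c) (fun _ => oneWeight A)
  refine le_trans (le_weightHom_iff.2 fun x => ?_) (h.trans (iSup_le fun _ => T.op_le_left _ _))
  rw [T.op_one]
  refine (hc x).trans ?_
  exact (T.op_one c).ge.trans (le_iSup (fun _ : Unit => T.op c 1) ())

/-- The weight `z ↦ A(x, z) → c`. -/
noncomputable def coyonedaImp (A : Cat T X) (x : X) (c : I) : Weight A where
  val z := T.imp (A.hom x z) c
  isWeight y z := by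
    rw [← T.op_le_iff, T.comm (T.imp _ _), ← T.assoc, T.comm (A.hom x y)]
    exact (T.mono_left _ _ _ (A.trans _ _ _)).trans (T.op_imp_le _ _)

theorem hom_coyonedaImp_lt_one {φ : Weight A} {x : X} {c : I} (h : c < φ.val x) :
    (weightCat A).hom φ (coyonedaImp A x c) < 1 := by
  refine lt_of_le_of_ne unitInterval.le_one' fun h1 => ?_
  have h2 := weightHom_eq_one_iff.1 h1 x
  have h3 : φ.val x ≤ T.imp (A.hom x x) c := h2
  rw [A.hom_self, T.one_imp] at h3
  exact absurd h3 (not_le.2 h)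

/-- `coyonedaImp A x r` is the largest weight with value at most `r` at `x`. The hom out of `φ` into
each of the two such weights is below 1, hence so is the hom into their join `χ`. Thus `χ z < φ z`
for some `z`, and `(z, χ z)` dominates both balls. -/
theorem IsIdeal.directedOn_ballsBelow {φ : Weight A} (hφ : IsIdeal A φ) :
    DirectedOn (· ≤ ·) (ballsBelow φ) := by
  intro p hp q hq
  have h := hφ.hom_combination_le (K := Bool) (fun _ => 1)
    (fun i => cond i (coyonedaImp A p.center p.radius) (coyonedaImp A q.center q.radius))
  set χ := Weight.combination (fun _ : Bool => (1 : I))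
    (fun i => cond i (coyonedaImp A p.center p.radius) (coyonedaImp A q.center q.radius))
  have hlt : (weightCat A).hom φ χ < 1 := by
    refine h.trans_lt ?_
    obtain ⟨k, hk⟩ := exists_eq_ciSup_of_finite (f := fun k : Bool => T.op 1 ((weightCat A).hom φ
      (cond k (coyonedaImp A p.center p.radius) (coyonedaImp A q.center q.radius))))
    rw [← hk, T.one_op]
    cases k
    · exact hom_coyonedaImp_lt_one hq
    · exact hom_coyonedaImp_lt_one hp
  have hex : ∃ z, χ.val z < φ.val z := by
    by_contra hcon
    push Not at hcon
    exact hlt.ne (weightHom_eq_one_iff.2 hcon)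
  obtain ⟨z, hz⟩ := hex
  have key : ∀ (x : X) (r : I), T.imp (A.hom x z) r ≤ χ.val z →
      (⟨x, r⟩ : FormalBall A) ≤ ⟨z, χ.val z⟩ := by
    intro x r hx
    -- Otherwise the implication is 1, contradicting `χ z < 1`. Divisibility then recovers `r` from
    -- it.
    have h1 : r ≤ A.hom x z := by
      by_contra hcon
      have h2 : (1 : I) ≤ T.imp (A.hom x z) r := by
        rw [← T.op_le_iff, T.op_one]
        exact (not_le.1 hcon).le
      exact absurd ((h2.trans hx).trans_lt hz) (not_lt.2 unitInterval.le_one')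
    show r ≤ T.op (χ.val z) (A.hom x z)
    rw [T.comm]
    exact (T.op_imp_of_le h1).ge.trans (T.mono _ _ _ hx)
  have hk : ∀ k : Bool, (cond k (coyonedaImp A p.center p.radius)
      (coyonedaImp A q.center q.radius)).val z ≤ χ.val z := by
    intro k
    have := le_iSup (fun k : Bool => T.op 1 ((cond k (coyonedaImp A p.center p.radius)
      (coyonedaImp A q.center q.radius)).val z)) k
    rwa [T.one_op] at this
  exact ⟨⟨z, χ.val z⟩, hz, key _ _ (hk true), key _ _ (hk false)⟩

/-- For an upper bound `(y, s)`, write `t = s & (s → t)` and cancel `s` ball by ball: the colimit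
property then gives `s → t ≤ A(b, y)`. -/
theorem isLUB_scale (hT : T.IsArchimedean) {D : Set (FormalBall A)} (hD : DirectedOn (· ≤ ·) D)
    (h1 : sSup (FormalBall.radius '' D) = 1) {b : X} (hb : IsColimit A (ballWeight D) b)
    {t : I} (ht : 0 < t) : IsLUB (FormalBall.scale t '' D) (⟨b, t⟩ : FormalBall A) := by
  constructor
  · rintro _ ⟨p, hp, rfl⟩
    refine T.mono _ _ _ (le_trans ?_ (hb.le_hom p.center))
    have := le_ballWeight hp p.center
    rwa [A.hom_self, T.op_one] at this
  · rintro ⟨y, s⟩ hy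
    have hub : ∀ p ∈ D, T.op t p.radius ≤ T.op s (A.hom p.center y) :=
      fun p hp => hy ⟨p, hp, rfl⟩
    have hts : t ≤ s := by
      rw [← T.op_one t, ← h1, T.op_sSup_le_iff]
      rintro _ ⟨p, hp, rfl⟩
      exact (hub p hp).trans (T.op_le_left _ _)
    have hpos : 0 < T.op t (sSup (FormalBall.radius '' D)) := by rwa [h1, T.op_one]
    -- Above `p₀` the products `t & r` are nonzero, so cancellation applies.
    obtain ⟨_, ⟨p₀, hp₀, rfl⟩, h0⟩ := (T.lt_op_sSup_iff _ _ _).1 hpos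
    have hst := T.op_imp_of_le hts
    show t ≤ T.op s (A.hom b y)
    refine hst.ge.trans (T.mono _ _ _ ?_)
    rw [hb y, le_hom_ballWeight_iff]
    intro p hp
    obtain ⟨q, hq, hpq, h0q⟩ := hD p hp p₀ hp₀
    refine op_radius_le_of_le hpq ?_
    have he : T.op s (T.op q.radius (T.imp s t)) = T.op t q.radius := by
      rw [T.op_left_comm, hst, T.comm]
    refine hT.cancel (t := s) ?_ ?_
    · rw [he]
      exact h0.trans_le (T.mono _ _ _ (FormalBall.radius_le h0q))
    · rw [he]
      exact hub q hq

theorem eq_of_isLUB (hT : T.IsArchimedean) {D : Set (FormalBall A)} {b c : X} {t u : I}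
    (hb : IsLUB D (⟨b, t⟩ : FormalBall A)) (hc : IsLUB D (⟨c, u⟩ : FormalBall A))
    (ht : 0 < t) : t = u ∧ A.hom b c = 1 ∧ A.hom c b = 1 := by
  have h1 : (⟨b, t⟩ : FormalBall A) ≤ ⟨c, u⟩ := hb.2 hc.1
  have h2 : (⟨c, u⟩ : FormalBall A) ≤ ⟨b, t⟩ := hc.2 hb.1
  have h : t = u := le_antisymm (FormalBall.radius_le h1) (FormalBall.radius_le h2)
  subst h
  exact ⟨rfl, hT.eq_one_of_op_eq ht (le_antisymm (T.op_le_left _ _) h1),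
    hT.eq_one_of_op_eq ht (le_antisymm (T.op_le_left _ _) h2)⟩

/-- Balls of radius 0 lie below everything, so they can be dropped to meet the positivity demanded
by standardness. -/
theorem isLUB_positive {D : Set (FormalBall A)} (hD : DirectedOn (· ≤ ·) D) {q : FormalBall A}
    (hq : IsLUB D q) (h0 : 0 < q.radius) :
    {p ∈ D | 0 < p.radius}.Nonempty ∧ DirectedOn (· ≤ ·) {p ∈ D | 0 < p.radius} ∧
      IsLUB {p ∈ D | 0 < p.radius} q := by
  have hz : ∀ p : FormalBall A, ¬ 0 < p.radius → p.radius = 0 := fun p hp =>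
    le_antisymm (not_lt.1 hp) unitInterval.nonneg'
  refine ⟨?_, ?_, fun p hp => hq.1 hp.1, fun x hx => hq.2 fun p hp => ?_⟩
  · by_contra hcon
    rw [Set.not_nonempty_iff_eq_empty, Set.eq_empty_iff_forall_notMem] at hcon
    have : q ≤ ⟨q.center, 0⟩ := hq.2 fun p hp =>
      FormalBall.le_of_radius_eq_zero (hz p fun h => hcon p ⟨hp, h⟩)
    exact absurd (FormalBall.radius_le this) (not_le.2 h0)
  · intro p hp p' hp'
    obtain ⟨z, hz, h1, h2⟩ := hD p hp.1 p' hp'.1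
    exact ⟨z, ⟨hz, hp.2.trans_le (FormalBall.radius_le h1)⟩, h1, h2⟩
  · by_cases h : 0 < p.radius
    · exact hx ⟨hp, h⟩
    · exact FormalBall.le_of_radius_eq_zero (hz p h)

/-- In a standard category, the join of a directed set of balls whose radii have supremum one is
a colimit of the weight that they generate. -/
theorem IsStandard.isColimit_of_isLUB (hT : T.IsArchimedean) (hA : IsStandard A)
    {D : Set (FormalBall A)} (hne : D.Nonempty) (hD : DirectedOn (· ≤ ·) D)
    (hpos : ∀ p ∈ D, 0 < p.radius) (h1 : sSup (FormalBall.radius '' D) = 1) {b : X}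
    (hb : IsLUB D (⟨b, 1⟩ : FormalBall A)) : IsColimit A (ballWeight D) b := by
  have hub : ∀ p ∈ D, p.radius ≤ A.hom p.center b := fun p hp => by
    have : p.radius ≤ T.op 1 (A.hom p.center b) := hb.1 hp
    rwa [T.one_op] at this
  refine fun y => eq_of_forall_le_iff fun t => ?_
  rw [le_hom_ballWeight_iff]
  constructor
  · intro ht p hp
    rw [T.comm]
    exact ((T.mono_left _ _ _ ht).trans (T.mono _ _ _ (hub p hp))).trans (A.trans _ _ _)
  intro ht
  rcases eq_or_lt_of_le (unitInterval.nonneg' : 0 ≤ t) with h0 | h0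
  · rw [← h0]
    exact unitInterval.nonneg'
  -- Standardness supplies a join of `t & D`. Its radius is `t` and `A(b, c) = 1`, so bounds on `t &
  -- D` pass to `b`.
  obtain ⟨⟨c, u⟩, hc⟩ := (hA D hne hD hpos ⟨_, hb⟩).1 t h0
  have hcub : ∀ p ∈ D, T.op t p.radius ≤ T.op u (A.hom p.center c) := fun p hp => hc.1 ⟨p, hp, rfl⟩
  have hcb : (⟨c, u⟩ : FormalBall A) ≤ ⟨b, t⟩ := hc.2 <| by
    rintro _ ⟨p, hp, rfl⟩
    exact T.mono _ _ _ (hub p hp)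
  have htu : t ≤ u := by
    rw [← T.op_one t, ← h1, T.op_sSup_le_iff]
    rintro _ ⟨p, hp, rfl⟩
    exact (hcub p hp).trans (T.op_le_left _ _)
  obtain rfl : t = u := le_antisymm htu (FormalBall.radius_le hcb)
  have hpos' : 0 < T.op t (sSup (FormalBall.radius '' D)) := by rwa [h1, T.op_one]
  obtain ⟨_, ⟨p₀, hp₀, rfl⟩, hp0⟩ := (T.lt_op_sSup_iff _ _ _).1 hpos'
  have hbc : (⟨b, 1⟩ : FormalBall A) ≤ ⟨c, 1⟩ := hb.2 fun p hp => by
    obtain ⟨q, hq, hpq, h0q⟩ := hD p hp p₀ hp₀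
    refine hpq.trans ?_
    show q.radius ≤ T.op 1 (A.hom q.center c)
    rw [T.one_op]
    exact hT.cancel (hp0.trans_le (T.mono _ _ _ (FormalBall.radius_le h0q))) (hcub q hq)
  have hbc' : (1 : I) ≤ A.hom b c := by
    have : (1 : I) ≤ T.op 1 (A.hom b c) := hbc
    rwa [T.one_op] at this
  have hcy : (⟨c, t⟩ : FormalBall A) ≤ ⟨y, 1⟩ := hc.2 <| by
    rintro _ ⟨p, hp, rfl⟩
    show T.op t p.radius ≤ T.op 1 (A.hom p.center y)
    rw [T.one_op, T.comm]
    exact ht p hp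
  have hcy' : t ≤ A.hom c y := by
    have : t ≤ T.op 1 (A.hom c y) := hcy
    rwa [T.one_op] at this
  have := (T.mono_left _ _ _ hcy').trans ((T.mono (A.hom c y) _ _ hbc').trans (A.trans _ _ _))
  rwa [T.op_one] at this

/-- In a standard category, the join `(c, u)` of a directed set of balls of positive radii comes
from a colimit of the weight generated by the rescaled balls. -/
theorem IsStandard.isColimit_unscale (hT : T.IsArchimedean) (hA : IsStandard A)
    {D : Set (FormalBall A)} (hne : D.Nonempty) (hD : DirectedOn (· ≤ ·) D)
    (hpos : ∀ p ∈ D, 0 < p.radius) {c : X} {u : I} (hc : IsLUB D (⟨c, u⟩ : FormalBall A)) :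
    DirectedOn (· ≤ ·) (FormalBall.unscale u '' D) ∧
      sSup (FormalBall.radius '' (FormalBall.unscale u '' D)) = 1 ∧
      IsColimit A (ballWeight (FormalBall.unscale u '' D)) c := by
  -- Standardness allows division only by the supremum `t` of the radii; that `t = u` emerges last,
  -- from comparing two joins of `D`.
  obtain ⟨t, htdef⟩ : ∃ t, t = sSup (FormalBall.radius '' D) := ⟨_, rfl⟩
  have hle : ∀ p ∈ D, p.radius ≤ t := fun p hp => htdef ▸ le_sSup ⟨p, hp, rfl⟩
  have ht0 : 0 < t := by
    obtain ⟨p, hp⟩ := hne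
    exact (hpos p hp).trans_le (hle p hp)
  have hne' : (FormalBall.unscale t '' D).Nonempty := hne.image _
  have hdir : DirectedOn (· ≤ ·) (FormalBall.unscale t '' D) := by
    rintro _ ⟨p, hp, rfl⟩ _ ⟨q, hq, rfl⟩
    obtain ⟨z, hz, h1, h2⟩ := hD p hp q hq
    exact ⟨_, ⟨z, hz, rfl⟩, unscale_le_unscale hT (hpos p hp) (hle z hz) h1,
      unscale_le_unscale hT (hpos q hq) (hle z hz) h2⟩
  have hpos' : ∀ p ∈ FormalBall.unscale t '' D, 0 < p.radius := by
    rintro _ ⟨p, hp, rfl⟩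
    exact (hpos p hp).trans_le (T.le_imp _ _)
  have hsup : sSup (FormalBall.radius '' (FormalBall.unscale t '' D)) = 1 := by
    refine hT.eq_one_of_op_eq ht0 (le_antisymm (T.op_le_left _ _) ?_)
    conv_lhs => rw [htdef]
    refine sSup_le ?_
    rintro _ ⟨p, hp, rfl⟩
    rw [← T.op_imp_of_le (hle p hp)]
    exact T.mono _ _ _ (le_sSup ⟨_, ⟨p, hp, rfl⟩, rfl⟩)
  obtain ⟨⟨b, v⟩, hb⟩ := (hA D hne hD hpos ⟨_, hc⟩).2
  rw [← htdef] at hb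
  have hb : IsLUB (FormalBall.unscale t '' D) (⟨b, v⟩ : FormalBall A) := hb
  obtain rfl : v = 1 := by
    refine le_antisymm unitInterval.le_one' (hsup.ge.trans (sSup_le ?_))
    rintro _ ⟨p, hp, rfl⟩
    exact FormalBall.radius_le (hb.1 hp)
  have hcol := hA.isColimit_of_isLUB hT hne' hdir hpos' hsup hb
  have hlub := isLUB_scale hT hdir hsup hcol ht0
  have him : FormalBall.scale t '' (FormalBall.unscale t '' D) = D := by
    rw [Set.image_image]
    exact (Set.image_congr fun p hp => scale_unscale (hle p hp)).trans (Set.image_id' D)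
  rw [him] at hlub
  obtain ⟨rfl, h1, h2⟩ := eq_of_isLUB hT hlub hc ht0
  exact ⟨hdir, hsup, hcol.of_iso h1 h2⟩

end Balls

/-! ### The way below relation of balls and the equivalence -/

section Continuity

variable {X : Type u} {A : Cat T X}

theorem WayBelow.of_le {P : Type u} [Preorder P] {x y z : P} (hxy : x ≤ y) (h : WayBelow y z) :
    WayBelow x z := fun D hne hD b hb hzb =>
  let ⟨d, hd, hyd⟩ := h D hne hD b hb hzb
  ⟨d, hd, hxy.trans hyd⟩

theorem WayBelow.le {P : Type u} [Preorder P] {x y : P} (h : WayBelow x y) : x ≤ y := by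
  obtain ⟨d, hd, hxd⟩ := h {y} (Set.singleton_nonempty y) (directedOn_singleton y) y
    isLUB_singleton le_rfl
  exact hxd.trans_eq hd

/-- Anything way below `q` is below a member of `E`, so `E` is cofinal among the approximants. -/
theorem wayBelow_basis {P : Type u} [Preorder P] {q : P} {E : Set P} (hne : E.Nonempty)
    (hE : DirectedOn (· ≤ ·) E) (hlub : IsLUB E q) (hwb : ∀ e ∈ E, WayBelow e q) :
    {y | WayBelow y q}.Nonempty ∧ DirectedOn (· ≤ ·) {y | WayBelow y q} ∧
      IsLUB {y | WayBelow y q} q := by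
  refine ⟨hne.mono hwb, fun x hx y hy => ?_, fun y hy => hy.le, fun b hb => ?_⟩
  · obtain ⟨d, hd, hxd⟩ := hx E hne hE q hlub le_rfl
    obtain ⟨e, he, hye⟩ := hy E hne hE q hlub le_rfl
    obtain ⟨z, hz, hdz, hez⟩ := hE d hd e he
    exact ⟨z, hwb z hz, hxd.trans hdz, hye.trans hez⟩
  · exact hlub.2 fun e he => hb (hwb e he)

theorem FormalBall.wayBelow_of_radius_eq_zero {p q : FormalBall A} (h : p.radius = 0) :
    WayBelow p q := fun _ ⟨d, hd⟩ _ _ _ _ => ⟨d, hd, FormalBall.le_of_radius_eq_zero h⟩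

theorem isIdeal_yoneda (x : X) : IsIdeal A (yoneda A x) := by
  have hy : ∀ ψ : Weight A, (weightCat A).hom (yoneda A x) ψ = ψ.val x := fun ψ => by
    refine eq_of_forall_le_iff fun c => ?_
    rw [le_weightHom_iff]
    constructor
    · intro h
      have := h x
      change T.op (A.hom x x) c ≤ _ at this
      rwa [A.hom_self, T.one_op] at this
    · intro h y
      rw [T.comm]
      exact (T.mono_left _ _ _ h).trans (ψ.isWeight y x)
  refine isIdeal_of_hom_combination_le fun K _ c ψ => ?_
  simp only [hy]
  exact le_rfl

theorem isColimit_yoneda (x : X) : IsColimit A (yoneda A x) x := fun y => by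
  refine eq_of_forall_le_iff fun c => ?_
  rw [le_weightHom_iff]
  constructor
  · intro h z
    rw [T.comm]
    exact (T.mono_left _ _ _ h).trans (A.trans z x y)
  · intro h
    have : T.op (A.hom x x) c ≤ A.hom x y := h x
    rwa [A.hom_self, T.one_op] at this

/-- A directed set with join `(c, u)`, divided by `u`, generates an ideal `φ` with colimit `c`, so
`r < u & φ x`. As `φ x` is a supremum over balls, one ball already witnesses this. -/
theorem wayBelow_of_lt (hT : T.IsArchimedean) (hA : IsStandard A) {x y : X} {r s : I}
    (h : r < T.op s (wayBelowDist A x y)) :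
    WayBelow (⟨x, r⟩ : FormalBall A) ⟨y, s⟩ := by
  rintro D - hD ⟨c, u⟩ hc hyc
  have hyc : s ≤ T.op u (A.hom y c) := hyc
  have hu : 0 < u :=
    (lt_of_le_of_lt unitInterval.nonneg' h).trans_le
      ((T.op_le_left _ _).trans (hyc.trans (T.op_le_left _ _)))
  obtain ⟨hne, hD', hc'⟩ := isLUB_positive hD hc hu
  set E := {p ∈ D | 0 < p.radius}
  obtain ⟨hdir, hsup, hcol⟩ := hA.isColimit_unscale hT hne hD' (fun p hp => hp.2) hc'
  let φ : IdealWithColimit A :=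
    ⟨ballWeight (FormalBall.unscale u '' E), isIdeal_ballWeight hT (hne.image _) hdir hsup, c, hcol⟩
  have hw : wayBelowDist A x y ≤ T.imp (A.hom y (colim A φ)) (φ.1.val x) :=
    iInf_le (fun φ : IdealWithColimit A => T.imp (A.hom y (colim A φ)) (φ.1.val x)) φ
  have hyφ : A.hom y c ≤ A.hom y (colim A φ) := by
    have := A.trans y c (colim A φ)
    rwa [hcol.hom_eq_one (isColimit_colim φ), T.one_op] at this
  have h2 : T.op (A.hom y c) (wayBelowDist A x y) ≤ φ.1.val x :=
    (T.mono_left _ _ _ hyφ).trans ((T.op_le_iff _ _ _).2 hw)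
  have h3 : r < T.op u (φ.1.val x) := by
    refine h.trans_le ((T.mono_left _ _ _ hyc).trans ?_)
    rw [T.assoc]
    exact T.mono _ _ _ h2
  obtain ⟨_, ⟨⟨_, p, hp, rfl⟩, rfl⟩, hr⟩ := (T.lt_op_sSup_iff _ _ _).1 h3
  refine ⟨p, hp.1, ?_⟩
  have hpu : p.radius ≤ u := FormalBall.radius_le (hc.1 hp.1)
  have hr : r < T.op u (T.op (T.imp u p.radius) (A.hom x p.center)) := hr
  rw [← T.assoc, T.op_imp_of_le hpu] at hr
  exact hr.le

/-- By adjunction, the infimum defining `𝔴(x, y)` is attained at `d y`. -/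
theorem IsContinuous.wayBelowDist_eq {d : X → IdealWithColimit A}
    (h : IsAdjunction A (idealCat A) d (colim A)) (x y : X) :
    wayBelowDist A x y = (d y).1.val x := by
  have hh : ∀ φ, (weightCat A).hom (d y).1 φ.1 = A.hom y (colim A φ) := h.2.2 y
  apply le_antisymm
  · refine (iInf_le _ (d y)).trans ?_
    rw [← hh, (weightCat A).hom_self, T.one_imp]
  · refine le_iInf fun φ => ?_
    rw [← T.op_le_iff, ← hh, T.comm]
    exact op_weightHom_le _ _ _

/-- The adjunction at `d y` and at the Yoneda weight of `y` gives the two halves of an isomorphism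
between `y` and `colim (d y)`. -/
theorem IsContinuous.isColimit {d : X → IdealWithColimit A}
    (h : IsAdjunction A (idealCat A) d (colim A)) (y : X) : IsColimit A (d y).1 y := by
  have hh : ∀ φ, (weightCat A).hom (d y).1 φ.1 = A.hom y (colim A φ) := h.2.2 y
  have hd := isColimit_colim (d y)
  have h1 : A.hom y (colim A (d y)) = 1 := by rw [← hh, (weightCat A).hom_self]
  let φ : IdealWithColimit A := ⟨yoneda A y, isIdeal_yoneda y, y, isColimit_yoneda y⟩
  have h2 : A.hom (colim A (d y)) y = 1 := by
    rw [hd y]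
    exact (hh φ).trans ((isColimit_yoneda y).hom_eq_one (isColimit_colim φ))
  exact hd.of_iso h2 h1

theorem IsIdeal.isLUB_scale_ballsBelow (hT : T.IsArchimedean) {φ : Weight A} (hφ : IsIdeal A φ)
    {b : X} (hb : IsColimit A φ b) {t : I} (ht : 0 < t) :
    (FormalBall.scale t '' ballsBelow φ).Nonempty ∧
      DirectedOn (· ≤ ·) (FormalBall.scale t '' ballsBelow φ) ∧
      IsLUB (FormalBall.scale t '' ballsBelow φ) (⟨b, t⟩ : FormalBall A) := by
  refine ⟨Set.Nonempty.image _ ?_, directedOn_scale hφ.directedOn_ballsBelow t,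
    isLUB_scale hT hφ.directedOn_ballsBelow hφ.sSup_eq_one (by rwa [ballWeight_ballsBelow]) ht⟩
  by_contra hcon
  rw [Set.not_nonempty_iff_eq_empty] at hcon
  have h1 := hφ.sSup_eq_one
  rw [hcon, Set.image_empty, sSup_empty] at h1
  have h0 : (⊥ : I) ≤ 0 := bot_le
  exact absurd (h1.ge.trans h0) (not_le.2 zero_lt_one)

theorem IsContinuous.wayBelow_iff (hT : T.IsArchimedean) (hA : IsStandard A)
    (hc : IsContinuous A) {x y : X} {r s : I} (hr : 0 < r) (hs : 0 < s) :
    WayBelow (⟨x, r⟩ : FormalBall A) ⟨y, s⟩ ↔ r < T.op s (wayBelowDist A x y) := by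
  refine ⟨fun h => ?_, wayBelow_of_lt hT hA⟩
  obtain ⟨d, hd⟩ := hc
  obtain ⟨hne, hdir, hlub⟩ :=
    (d y).2.1.isLUB_scale_ballsBelow hT (IsContinuous.isColimit hd y) hs
  obtain ⟨_, ⟨⟨z, p⟩, hp, rfl⟩, hle⟩ := h _ hne hdir _ hlub le_rfl
  have hp : p < (d y).1.val z := hp
  have hle : r ≤ T.op (T.op s p) (A.hom x z) := hle
  rw [IsContinuous.wayBelowDist_eq hd]
  have h1 : T.op (T.op s (A.hom x z)) ((d y).1.val z) ≤ T.op s ((d y).1.val x) := by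
    rw [T.assoc, T.comm (A.hom x z)]
    exact T.mono _ _ _ ((d y).1.isWeight x z)
  refine lt_of_lt_of_le (lt_of_le_of_lt hle ?_) h1
  rw [T.op_right_comm]
  rw [T.op_right_comm] at hle
  -- Strictness of `p < d y z` survives multiplication, since the product is at least `r > 0`.
  by_contra hcon
  rw [not_lt] at hcon
  have hmono := T.mono (T.op s (A.hom x z)) _ _ hp.le
  exact absurd (hT.cancel (hr.trans_le (hle.trans hmono)) hcon) (not_le.2 hp)

theorem IsContinuous.isContinuousOrder (hT : T.IsArchimedean) (hA : IsStandard A)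
    (hc : IsContinuous A) : IsContinuousOrder (FormalBall A) := by
  rintro ⟨y, s⟩
  rcases eq_or_lt_of_le (unitInterval.nonneg' : 0 ≤ s) with h0 | h0
  · refine wayBelow_basis (Set.singleton_nonempty _) (directedOn_singleton _)
      isLUB_singleton ?_
    rintro e rfl
    exact FormalBall.wayBelow_of_radius_eq_zero h0.symm
  · obtain ⟨d, hd⟩ := hc
    obtain ⟨hne, hdir, hlub⟩ :=
      (d y).2.1.isLUB_scale_ballsBelow hT (IsContinuous.isColimit hd y) h0
    refine wayBelow_basis hne hdir hlub ?_
    rintro _ ⟨⟨z, p⟩, hp, rfl⟩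
    have hp : p < (d y).1.val z := hp
    -- Cancellation needs a nonzero product; a ball of radius 0 is way below everything.
    rcases eq_or_lt_of_le (unitInterval.nonneg' : 0 ≤ T.op s p) with h1 | h1
    · exact FormalBall.wayBelow_of_radius_eq_zero h1.symm
    · refine wayBelow_of_lt hT hA ?_
      rw [IsContinuous.wayBelowDist_eq hd]
      by_contra hcon
      rw [not_lt] at hcon
      exact absurd (hT.cancel (h1.trans_le (T.mono _ _ _ hp.le)) hcon) (not_le.2 hp)

/-- The balls of positive radii way below `(y, t)`. -/
def positiveWayBelow (A : Cat T X) (y : X) (t : I) : Set (FormalBall A) :=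
  {p ∈ {p : FormalBall A | WayBelow p ⟨y, t⟩} | 0 < p.radius}

theorem IsContinuousOrder.positiveWayBelow (hc : IsContinuousOrder (FormalBall A)) (y : X) {t : I}
    (ht : 0 < t) : (positiveWayBelow A y t).Nonempty ∧
      DirectedOn (· ≤ ·) (positiveWayBelow A y t) ∧
      IsLUB (positiveWayBelow A y t) (⟨y, t⟩ : FormalBall A) :=
  isLUB_positive (hc ⟨y, t⟩).2.1 (hc ⟨y, t⟩).2.2 ht

theorem unscale_one (p : FormalBall A) : p.unscale 1 = p := by
  ext1
  · rfl
  · exact T.one_imp _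

theorem image_scale_one (D : Set (FormalBall A)) : FormalBall.scale 1 '' D = D := by
  refine (Set.image_congr fun p _ => ?_).trans (Set.image_id' D)
  ext1
  · rfl
  · exact T.one_op _

/-- The approximants of `(y, t)`, divided by `t`, have join `(y, 1)`, so one of them dominates `p`;
multiplying back puts `t & p` below an approximant of `(y, t)`. -/
theorem IsContinuousOrder.scale_wayBelow (hT : T.IsArchimedean) (hA : IsStandard A)
    (hc : IsContinuousOrder (FormalBall A)) {p : FormalBall A} {y : X}
    (h : WayBelow p (⟨y, 1⟩ : FormalBall A)) {t : I} (ht : 0 < t) :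
    WayBelow (p.scale t) (⟨y, t⟩ : FormalBall A) := by
  obtain ⟨hne, hdir, hlub⟩ := hc.positiveWayBelow y ht
  obtain ⟨hdir', hsup, hcol⟩ := hA.isColimit_unscale hT hne hdir (fun p hp => hp.2) hlub
  have hlub' := isLUB_scale hT hdir' hsup hcol zero_lt_one
  rw [image_scale_one] at hlub'
  obtain ⟨_, ⟨q, hq, rfl⟩, hpq⟩ := h _ (hne.image _) hdir' _ hlub' le_rfl
  have h1 := FormalBall.scale_mono t hpq
  rw [scale_unscale (FormalBall.radius_le (hlub.1 hq))] at h1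
  exact WayBelow.of_le h1 hq.1

theorem IsContinuousOrder.isContinuous (hT : T.IsArchimedean) (hA : IsStandard A)
    (hc : IsContinuousOrder (FormalBall A)) : IsContinuous A := by
  have key : ∀ y, IsIdeal A (ballWeight (RealEnriched.positiveWayBelow A y 1)) ∧
      IsColimit A (ballWeight (RealEnriched.positiveWayBelow A y 1)) y := by
    intro y
    obtain ⟨hne, hdir, hlub⟩ := hc.positiveWayBelow y zero_lt_one
    obtain ⟨-, hsup, hcol⟩ := hA.isColimit_unscale hT hne hdir (fun p hp => hp.2) hlub
    have him : FormalBall.unscale 1 '' RealEnriched.positiveWayBelow A y 1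
        = RealEnriched.positiveWayBelow A y 1 :=
      (Set.image_congr fun p _ => unscale_one p).trans (Set.image_id' _)
    rw [him] at hsup hcol
    exact ⟨isIdeal_ballWeight hT hne hdir hsup, hcol⟩
  refine ⟨fun y => ⟨_, (key y).1, y, (key y).2⟩, isAdjunction_of_hom_eq fun y φ => ?_⟩
  show (weightCat A).hom (ballWeight (RealEnriched.positiveWayBelow A y 1)) φ.1
    = A.hom y (colim A φ)
  have hφ := isColimit_colim φ
  apply le_antisymm
  · rw [(key y).2 (colim A φ)]
    exact le_weightHom_iff.2 fun x => (op_weightHom_le _ _ x).trans (hφ.le_hom x)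
  · rw [le_hom_ballWeight_iff]
    intro p hp
    set t := A.hom y (colim A φ) with ht
    rcases eq_or_lt_of_le (unitInterval.nonneg' : 0 ≤ t) with h0 | h0
    · rw [← h0, T.op_zero]
      exact unitInterval.nonneg'
    · obtain ⟨hne, hdir, hlub⟩ := φ.2.1.isLUB_scale_ballsBelow hT hφ zero_lt_one
      rw [image_scale_one] at hne hdir hlub
      have hle : (⟨y, t⟩ : FormalBall A) ≤ ⟨colim A φ, 1⟩ := by
        show t ≤ T.op 1 (A.hom y (colim A φ))
        rw [T.one_op]
      -- Here `t & p ≪ (y, t) ⊑ (colim φ, 1)`, and the last ball is a join of the balls below `φ`.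
      obtain ⟨q, hq, hpq⟩ := hc.scale_wayBelow hT hA hp.1 h0 _ hne hdir _ hlub hle
      have hpq : T.op t p.radius ≤ T.op q.radius (A.hom p.center q.center) := hpq
      rw [T.comm]
      exact (hpq.trans (T.mono_left _ _ _ (le_of_lt hq))).trans (φ.1.isWeight _ _)

end Continuity

end RealEnriched

theorem mainTheorem8 {T : RealEnriched.ContinuousTNorm} (hT : T.IsArchimedean)
    {X : Type*} (A : RealEnriched.Cat T X) (hA : RealEnriched.IsStandard A) :
    (RealEnriched.IsContinuous A ↔
      RealEnriched.IsContinuousOrder (RealEnriched.FormalBall A)) ∧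
    (RealEnriched.IsContinuous A →
      ∀ (x y : X) (r s : unitInterval), 0 < r → 0 < s →
        (RealEnriched.WayBelow (⟨x, r⟩ : RealEnriched.FormalBall A) ⟨y, s⟩ ↔
          r < T.op s (RealEnriched.wayBelowDist A x y))) :=
  ⟨⟨fun h => h.isContinuousOrder hT hA, fun h => h.isContinuous hT hA⟩,
    fun h _ _ _ _ hr hs => h.wayBelow_iff hT hA hr hs⟩
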